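/- Terms are pure untyped $\lambda$-terms up to $\alpha$-equivalence. Write $I=\lambda x.x$, $\delta=\lambda x.(x\ x)$, $\Omega=(\delta\ \delta)$, and let $c_k$ be the Church numeral of $k$. A term is solvable if it $\beta$-reduces to a head normal form $\lambda \vec z.(y\ \vec w)$ with $y$ a variable. Let $\triangleright^*$ be $\beta$-reduction in any number of steps, and let $\triangleright_{\beta\Omega}^*$ be the reflexive transitive closure of $\beta$-reduction together with the replacement, in any context, of an unsolvable sub-term by $\Omega$. A reduct of $t$ is a term $t'$ with $t\triangleright_{\beta\Omega}^* t'$. Write $u\simeq v$ if $u$ and $v$ have a common reduct, $[t]_{\mathcal H}$ for the class of $t$ modulo $\simeq$, and $F[u]$ for $F[x:=u]$. The range in $\mathcal H$ of a closed term $\lambda x.F$ is $\{[F[u]]_{\mathcal H} : u \text{ a closed term}\}$. A variable $\nu$ is persisting in $t$ if it occurs free in every reduct of $t$ and no reduct of $t$ has a sub-term of the form $(\nu\ u)$ with this free variable $\nu$. Let $Y$ be Turing's fixed point operator $(\theta\ \theta)$, $\theta=\lambda x\lambda y.(y\ (x\ x\ y))$. For $p\in\mathbb N$ let $$J^{(p)}=(Y\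 \lambda k\lambda n\lambda u\lambda y_1\ldots\lambda y_p.(u\ (k\ n\ y_1)\ldots(k\ n\ y_p))),$$ so that $(J^{(p)}\ \nu\ u)\triangleright^*\lambda y_1\ldots\lambda y_p.(u\ (J^{(p)}\ \nu\ y_1)\ldots(J^{(p)}\ \nu\ y_p))$. For closed terms $H$ and $S$ let $$\widehat J_{H,S}=(Y\ \lambda z\lambda k\lambda n\lambda x.(H\ k\ T\ I\ x)),\qquad T=\lambda a\lambda b\lambda c.(a\ (b\ (z\ (S\ k)\ n\ c))).$$ If $(H\ c_m)\triangleright^* c_{h(m)}$ and $(S\ c_m)\triangleright^* c_{m+1}$ for all $m$, then $(\widehat J_{H,S}\ c_m\ \nu\ u)$ has the same kind of expansion with $h(m)$ abstractions and with $(\widehat J_{H,S}\ c_{m+1}\ \nu\ y_i)$ as arguments of $u$. **Proposition.** Let $\lambda x.F$ and $A$ be closed terms, and let $A'$ be a term of one of the following two forms: 1. $A'=(J^{(p)}\ \nu\ A)$ for some $p\in\mathbb N$; 2. $A'=(\widehat J_{H,S}\ c_0\ \nu\ A)$ for some function $h:\mathbb N\to\mathbb N$ and closed terms $H,S$ such that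 $(H\ c_m)\triangleright^* c_{h(m)}$ and $(S\ c_m)\triangleright^* c_{m+1}$ for all $m\in\mathbb N$. Assume that $\nu$ is persisting in $F[A']$. Let $(t_n)_{n\in\mathbb N}$ be a sequence of pairwise distinct closed $\beta$-normal terms such that no $t_n$ occurs as a sub-term of any reduct of $F[A']$. Then the range of $\lambda x.F$ in $\mathcal H$ is infinite; moreover the classes $[F[A'[\nu:=t_n]]]_{\mathcal H}$, $n\in\mathbb N$, belong to this range and are pairwise distinct. -/

import Mathlib

/-! Untyped lambda-terms in de Bruijn notation (so alpha-equivalent terms are equal),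
beta-Omega-reduction, the range of a term in the theory H, and the infinite eta-expansions. -/

namespace LambdaH

/-- Pure lambda-terms; `var i` points to the `i`-th enclosing binder, and to a free variable if
there are at most `i` enclosing binders. -/
inductive Term : Type
  | var : ℕ → Term
  | app : Term → Term → Term
  | lam : Term → Term

namespace Term

/-- Renaming of the free variables. -/
def rename : (ℕ → ℕ) → Term → Term
  | r, var i => var (r i)
  | r, app t u => app (rename r t) (rename r u)
  | r, lam t => lam (rename (fun i => Nat.casesOn i 0 (fun j => r j + 1)) t)

/-- A substitution pushed under one binder. -/
def up (s : ℕ → Term) : ℕ → Term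
  | 0 => var 0
  | i + 1 => rename Nat.succ (s i)

/-- Simultaneous capture-avoiding substitution. -/
def subst : (ℕ → Term) → Term → Term
  | s, var i => s i
  | s, app t u => app (subst s t) (subst s u)
  | s, lam t => lam (subst (up s) t)

/-- `inst t u` is `t` with `u` substituted for the free variable `0`; the other free variables move
down by one. So `(fun x, t) u` beta-reduces to `inst t u`. If `0` is the only free
variable `x` of `t`, this is `t[x := u]`. -/
def inst (t u : Term) : Term :=
  subst (fun i => Nat.casesOn i u var) t

/-- All free variables of the term are smaller than `k`. -/
def ClosedBelow : ℕ → Term → Prop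
  | k, var i => i < k
  | k, app t u => ClosedBelow k t ∧ ClosedBelow k u
  | k, lam t => ClosedBelow (k + 1) t

/-- Closed terms. -/
def Closed (t : Term) : Prop := ClosedBelow 0 t

/-- The free variable `k` occurs in the term. -/
def Occurs : ℕ → Term → Prop
  | k, var i => i = k
  | k, app t u => Occurs k t ∨ Occurs k u
  | k, lam t => Occurs (k + 1) t

/-- The free variable `k` is applied in the term: if `k` is `ν`, some sub-term is `(ν u)`. -/
def Applied : ℕ → Term → Prop
  | _, var _ => False
  | k, app t u => t = var k ∨ Applied k t ∨ Applied k u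
  | k, lam t => Applied (k + 1) t

/-- `Subterm s t`: `s` is a sub-term of `t`. (A closed term is represented in the same way under any
number of binders.) -/
inductive Subterm : Term → Term → Prop
  | refl (t : Term) : Subterm t t
  | appL {s t u : Term} : Subterm s t → Subterm s (app t u)
  | appR {s t u : Term} : Subterm s u → Subterm s (app t u)
  | lam {s t : Term} : Subterm s t → Subterm s (lam t)

/-- One step of beta-reduction, anywhere in the term. -/
inductive Beta : Term → Term → Prop
  | beta (t u : Term) : Beta (app (lam t) u) (inst t u)
  | appL {t t' u : Term} : Beta t t' → Beta (app t u) (app t' u)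
  | appR {t u u' : Term} : Beta u u' → Beta (app t u) (app t u')
  | lam {t t' : Term} : Beta t t' → Beta (lam t) (lam t')

/-- Terms of the form `(y w₁ ... wₘ)` with `y` a variable. -/
inductive VarHeaded : Term → Prop
  | var (i : ℕ) : VarHeaded (var i)
  | app {t : Term} (u : Term) : VarHeaded t → VarHeaded (app t u)

/-- Head normal forms: abstractions in front of a term `(y w₁ ... wₘ)`. -/
inductive HeadNormal : Term → Prop
  | head {t : Term} : VarHeaded t → HeadNormal t
  | lam {t : Term} : HeadNormal t → HeadNormal (lam t)

/-- Solvable terms: those having a head normal form. -/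
def Solvable (t : Term) : Prop := ∃ s, Relation.ReflTransGen Beta t s ∧ HeadNormal s

/-- Beta-normal terms. -/
def Normal (t : Term) : Prop := ∀ s, ¬ Beta t s

/-- The term `I`. -/
def I : Term := lam (var 0)

/-- The term `δ`. -/
def delta : Term := lam (app (var 0) (var 0))

/-- The term `Ω = (δ δ)`. -/
def Omega : Term := app delta delta

/-- One step of Omega-reduction: some unsolvable sub-term is replaced by `Ω`. -/
inductive OmegaStep : Term → Term → Prop
  | omega {t : Term} : ¬ Solvable t → OmegaStep t Omega
  | appL {t t' u : Term} : OmegaStep t t' → OmegaStep (app t u) (app t' u)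
  | appR {t u u' : Term} : OmegaStep u u' → OmegaStep (app t u) (app t u')
  | lam {t t' : Term} : OmegaStep t t' → OmegaStep (lam t) (lam t')

/-- One step of beta-Omega-reduction. -/
def BetaOmega (t u : Term) : Prop := Beta t u ∨ OmegaStep t u

/-- `Reduces t u`: `u` is a (beta-Omega-)reduct of `t`. -/
def Reduces : Term → Term → Prop := Relation.ReflTransGen BetaOmega

/-- Equality in the theory H: existence of a common beta-Omega-reduct. -/
def HEquiv (u v : Term) : Prop := ∃ w, Reduces u w ∧ Reduces v w

/-- The class of `t` modulo `HEquiv`. -/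
def hClass (t : Term) : Set Term := {s | HEquiv t s}

/-- The range in H of the abstraction `λx.F`, where `x` is the free variable `0` of `F`. -/
def hRange (F : Term) : Set (Set Term) := {c | ∃ u, Closed u ∧ c = hClass (inst F u)}

/-- The free variable `ν` (which is `0`) is persisting in `t`: it occurs in every reduct of `t`,
and it is applied in none. -/
def Persisting (t : Term) : Prop :=
  (∀ t', Reduces t t' → Occurs 0 t') ∧ (∀ t', Reduces t t' → ¬ Applied 0 t')

/-- `lams p t` is `t` under `p` abstractions. -/
def lams : ℕ → Term → Term
  | 0, t => t
  | p + 1, t => lam (lams p t)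

/-- `apps t [u₁, ..., uₙ]` is `(t u₁ ... uₙ)`. -/
def apps (t : Term) (l : List Term) : Term := l.foldl app t

/-- The Church numeral `c_k = λf λx. (f (f ... (f x)))`. -/
def church (k : ℕ) : Term := lam (lam ((app (var 1))^[k] (var 0)))

/-- The closed term `H` represents the function `h`. -/
def Represents (H : Term) (h : ℕ → ℕ) : Prop :=
  Closed H ∧ ∀ k, Relation.ReflTransGen Beta (app H (church k)) (church (h k))

/-- One half of Turing's fixed point operator: `λx λy. (y (x x y))`. -/
def turingHalf : Term := lam (lam (app (var 0) (app (app (var 1) (var 1)) (var 0))))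

/-- Turing's fixed point operator `Y`. -/
def turing : Term := app turingHalf turingHalf

/-- The expansion term with a fixed number `p` of abstractions:
`J = (Y λk λn λu λy₁ ... λyₚ. (u (k n y₁) ... (k n yₚ)))`, so that
`(J ν u)` reduces to `λy₁ ... λyₚ. (u (J ν y₁) ... (J ν yₚ))`.
Under the binders, `yᵢ`, `u`, `n`, `k` are the variables `p - i`, `p`, `p + 1`, `p + 2`. -/
def J (p : ℕ) : Term :=
  app turing (lam (lam (lam (lams p (apps (var p)
    ((List.range p).reverse.map (fun i => app (app (var (p + 2)) (var (p + 1))) (var i))))))))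

/-- The expansion term with a number of abstractions that depends on a numeral:
`Jhat = (Y λz λk λn λx. (H k T I x))` with `T = λa λb λc. (a (b (z (S k) n c)))`. If `H` represents
`h` and `S` the successor, `(Jhat c_m ν u)` reduces to
`λy₁ ... λyᵣ. (u (Jhat c_(m+1) ν y₁) ... (Jhat c_(m+1) ν yᵣ))`, where `r = h m`.
Here `H` and `S` are closed; in `T` the variables `c b a x n k z` are `0, ..., 6`. -/
def Jhat (H S : Term) : Term :=
  app turing (lam (lam (lam (lam
    (apps H
      [var 2,
       lam (lam (lam (app (var 2) (app (var 1) (apps (var 6) [app S (var 5), var 4, var 0]))))),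
       I,
       var 0])))))

/-- `A'` is an infinite eta-expansion of the closed term `A`, with free variable `ν` (which is `0`):
either `A' = (J ν A)`, or `A' = (Jhat c_0 ν A)` for some closed terms that represent a function `h`
and the successor function. -/
def IsExpansion (A A' : Term) : Prop :=
  (∃ p, A' = apps (J p) [var 0, A]) ∨
  (∃ (h : ℕ → ℕ) (H S : Term), Represents H h ∧ Represents S Nat.succ ∧
    A' = apps (Jhat H S) [church 0, var 0, A])

end Term

end LambdaH

/-!
Put `B = F[A']`. Since `ν` is applied in no reduct of `B` and each `tₙ` is closed and normal, the
substitution `ν := tₙ` creates no redex and no unsolvable sub-term, so every reduct of `B[tₙ]` is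
`B'[tₙ]` for a reduct `B'` of `B` (`Inert.lift_reduces`). Suppose that `B[tₘ]` and `B[tₙ]` have a
common reduct `B'[tₘ] = B''[tₙ]`. As `ν` occurs in `B'`, the term `tₘ` is a sub-term of `B''[tₙ]`.
It is not a sub-term of `B''`, so it is either a sub-term of `tₙ`, or an instance `s[tₙ]` of a
sub-term `s ≠ ν` of `B''` in which `ν` occurs. Once the latter is excluded, `tₘ` and `tₙ` are
sub-terms of each other by symmetry, hence equal.

The exclusion rests on the shape of `A'`: in every reduct of `B`, the variable `ν` only occurs as the
argument of a term `P` of the expansion machinery, which contains neither `ν` nor any variable bound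
outside the machinery. If `s[tₙ]` is closed, then `P` is closed; but a closed term is never normal
when applied, since a closed normal term is an abstraction. So `s[tₙ]` is not normal, while `tₘ` is.

The invariant on `ν` is expressed by a type system (`HasTy`) with a type `name` for `ν`, a type
`top` for arbitrary terms, a type `data` for closed data such as numerals, function types, and a
recursive type for the self-application in Turing's fixed point operator. The head of both expansions
is typable with `name → top`, preceded by an argument of type `data` for `Jhat` (`hasTy_J`,
`hasTy_Jhat`), and typing is preserved under beta-Omega-reduction (`HasTy.reduces`). Each type
restricts the free variables of its terms; this is what makes `P` closed.
-/

namespace LambdaH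

namespace Term

/-! ### Renamings and substitutions as functions -/

/-- A renaming pushed under one binder. -/
def upRen (r : ℕ → ℕ) : ℕ → ℕ
  | 0 => 0
  | i + 1 => r i + 1

theorem rename_lam (r : ℕ → ℕ) (t : Term) : rename r (lam t) = lam (rename (upRen r) t) := by
  have : upRen r = fun i => Nat.casesOn i 0 (fun j => r j + 1) := by
    funext i; cases i <;> rfl
  rw [this]; rfl

/-- The substitution used by `inst`. -/
def single (u : Term) : ℕ → Term
  | 0 => u
  | i + 1 => var i

theorem inst_eq (t u : Term) : inst t u = subst (single u) t := by
  have : single u = fun i => Nat.casesOn i u var := by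
    funext i; cases i <;> rfl
  rw [this]; rfl

/-! ### Free variables and closed terms -/

theorem occurs_rename {t : Term} : ∀ {r : ℕ → ℕ} {j : ℕ},
    Occurs j (rename r t) ↔ ∃ i, Occurs i t ∧ r i = j := by
  induction t with
  | var i =>
    intro r j
    exact ⟨fun h => ⟨i, rfl, h⟩, fun ⟨k, hk, h⟩ => by cases hk; exact h⟩
  | app t u iht ihu =>
    intro r j
    simp only [rename, Occurs, iht, ihu, or_and_right, exists_or]
  | lam t ih =>
    intro r j
    simp only [rename_lam, Occurs, ih]
    constructor
    · rintro ⟨i, hi, e⟩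
      cases i with
      | zero => cases e
      | succ i => exact ⟨i, hi, Nat.succ.inj e⟩
    · rintro ⟨i, hi, e⟩
      exact ⟨i + 1, hi, congrArg Nat.succ e⟩

theorem occurs_subst {t : Term} : ∀ {s : ℕ → Term} {j : ℕ},
    Occurs j (subst s t) ↔ ∃ i, Occurs i t ∧ Occurs j (s i) := by
  induction t with
  | var i =>
    intro s j
    exact ⟨fun h => ⟨i, rfl, h⟩, fun ⟨k, hk, h⟩ => by cases hk; exact h⟩
  | app t u iht ihu =>
    intro s j
    simp only [subst, Occurs, iht, ihu, or_and_right, exists_or]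
  | lam t ih =>
    intro s j
    simp only [subst, Occurs, ih]
    constructor
    · rintro ⟨i, hi, h⟩
      cases i with
      | zero => cases h
      | succ i =>
        obtain ⟨k, hk, e⟩ := occurs_rename.1 h
        cases e
        exact ⟨i, hi, hk⟩
    · rintro ⟨i, hi, h⟩
      exact ⟨i + 1, hi, occurs_rename.2 ⟨j, h, rfl⟩⟩

theorem closedBelow_iff {t : Term} : ∀ {k : ℕ}, ClosedBelow k t ↔ ∀ i, Occurs i t → i < k := by
  induction t with
  | var i => intro k; exact ⟨fun h j hj => by cases hj; exact h, fun h => h i rfl⟩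
  | app t u iht ihu =>
    intro k
    simp only [ClosedBelow, Occurs, iht, ihu, or_imp, forall_and]
  | lam t ih =>
    intro k
    simp only [ClosedBelow, Occurs, ih]
    constructor
    · intro h i hi
      exact Nat.lt_of_succ_lt_succ (h _ hi)
    · intro h i hi
      cases i with
      | zero => exact Nat.succ_pos k
      | succ i => exact Nat.succ_lt_succ (h i hi)

theorem closed_iff {t : Term} : Closed t ↔ ∀ i, ¬ Occurs i t := by
  simp [Closed, closedBelow_iff]

/-! ### Substitution calculus -/

theorem subst_congr {t : Term} : ∀ {s s' : ℕ → Term},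
    (∀ i, Occurs i t → s i = s' i) → subst s t = subst s' t := by
  induction t with
  | var i => intro s s' h; exact h i rfl
  | app t u iht ihu =>
    intro s s' h
    simp only [subst]
    rw [iht fun i hi => h i (Or.inl hi), ihu fun i hi => h i (Or.inr hi)]
  | lam t ih =>
    intro s s' h
    simp only [subst]
    rw [ih]
    intro i hi
    cases i with
    | zero => rfl
    | succ i => simp only [up]; rw [h i hi]

theorem up_var : up var = var := by
  funext i; cases i <;> rfl

theorem subst_var (t : Term) : subst var t = t := by
  induction t with
  | var i => rfl
  | app t u iht ihu => simp only [subst, iht, ihu]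
  | lam t ih => simp only [subst, up_var, ih]

theorem rename_eq_subst (t : Term) : ∀ r : ℕ → ℕ, rename r t = subst (fun i => var (r i)) t := by
  induction t with
  | var i => intro r; rfl
  | app t u iht ihu => intro r; simp only [rename, subst, iht, ihu]
  | lam t ih =>
    intro r
    rw [rename_lam, subst, ih]
    congr 2
    funext i; cases i <;> rfl

theorem subst_eq_self {t : Term} {s : ℕ → Term} (h : ∀ i, Occurs i t → s i = var i) :
    subst s t = t := by
  rw [subst_congr h]; exact subst_var t

theorem Closed.subst_eq {t : Term} (h : Closed t) (s : ℕ → Term) : subst s t = t :=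
  subst_eq_self fun i hi => absurd hi (closed_iff.1 h i)

theorem Closed.rename_eq {t : Term} (h : Closed t) (r : ℕ → ℕ) : rename r t = t := by
  rw [rename_eq_subst, h.subst_eq]

theorem subst_rename (t : Term) : ∀ (s : ℕ → Term) (r : ℕ → ℕ),
    subst s (rename r t) = subst (fun i => s (r i)) t := by
  induction t with
  | var i => intro s r; rfl
  | app t u iht ihu => intro s r; simp only [rename, subst, iht, ihu]
  | lam t ih =>
    intro s r
    rw [rename_lam, subst, subst, ih]
    congr 2
    funext i; cases i <;> rfl

theorem rename_subst (t : Term) : ∀ (s : ℕ → Term) (r : ℕ → ℕ),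
    rename r (subst s t) = subst (fun i => rename r (s i)) t := by
  induction t with
  | var i => intro s r; rfl
  | app t u iht ihu => intro s r; simp only [rename, subst, iht, ihu]
  | lam t ih =>
    intro s r
    rw [subst, rename_lam, subst, ih]
    congr 2
    funext i
    cases i with
    | zero => rfl
    | succ i =>
      simp only [up]
      rw [rename_eq_subst, subst_rename, rename_eq_subst (rename r (s i)), subst_rename]
      rfl

theorem subst_subst (t : Term) : ∀ s s' : ℕ → Term,
    subst s' (subst s t) = subst (fun i => subst s' (s i)) t := by
  induction t with
  | var i => intro s s'; rfl
  | app t u iht ihu => intro s s'; simp only [subst, iht, ihu]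
  | lam t ih =>
    intro s s'
    simp only [subst]
    rw [ih]
    congr 2
    funext i
    cases i with
    | zero => rfl
    | succ i =>
      simp only [up]
      rw [subst_rename, rename_subst]
      rfl

theorem subst_inst (s : ℕ → Term) (t u : Term) :
    subst s (inst t u) = inst (subst (up s) t) (subst s u) := by
  rw [inst_eq, inst_eq, subst_subst, subst_subst]
  congr 1
  funext i
  cases i with
  | zero => rfl
  | succ i =>
    simp only [up]
    rw [subst_rename]
    exact (subst_var (s i)).symm

/-! ### Reduction, substitution and normal terms -/

theorem Beta.subst {t t' : Term} (h : Beta t t') :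
    ∀ s : ℕ → Term, Beta (subst s t) (subst s t') := by
  induction h with
  | beta t u => intro s; rw [subst_inst]; exact Beta.beta _ _
  | appL _ ih => intro s; exact Beta.appL (ih s)
  | appR _ ih => intro s; exact Beta.appR (ih s)
  | lam _ ih => intro s; exact Beta.lam (ih _)

theorem Beta.occurs {t t' : Term} (h : Beta t t') : ∀ {i}, Occurs i t' → Occurs i t := by
  induction h with
  | beta t u =>
    intro i hi
    rw [inst_eq, occurs_subst] at hi
    obtain ⟨j, hj, hi⟩ := hi
    cases j with
    | zero => exact Or.inr hi
    | succ j => cases hi; exact Or.inl hj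
  | appL _ ih => exact fun hi => hi.imp ih id
  | appR _ ih => exact fun hi => hi.imp id ih
  | lam _ ih => exact fun hi => ih hi

theorem not_occurs_omega (i : ℕ) : ¬ Occurs i Omega := by
  simp [Omega, delta, Occurs]

theorem OmegaStep.occurs {t t' : Term} (h : OmegaStep t t') : ∀ {i}, Occurs i t' → Occurs i t := by
  induction h with
  | omega _ => exact fun hi => absurd hi (not_occurs_omega _)
  | appL _ ih => exact fun hi => hi.imp ih id
  | appR _ ih => exact fun hi => hi.imp id ih
  | lam _ ih => exact fun hi => ih hi

theorem Normal.appL {t u : Term} (h : Normal (app t u)) : Normal t :=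
  fun _ hs => h _ (Beta.appL hs)

theorem Normal.appR {t u : Term} (h : Normal (app t u)) : Normal u :=
  fun _ hs => h _ (Beta.appR hs)

theorem Normal.lam {t : Term} (h : Normal (lam t)) : Normal t :=
  fun _ hs => h _ (Beta.lam hs)

theorem Normal.headNormal {t : Term} (h : Normal t) : HeadNormal t := by
  induction t with
  | var i => exact .head (.var i)
  | app t u iht _ =>
    cases iht h.appL with
    | head ht => exact .head (.app u ht)
    | lam _ => exact absurd (Beta.beta _ _) (h _)
  | lam t ih => exact .lam (ih h.lam)

theorem VarHeaded.not_closed {t : Term} (h : VarHeaded t) : ∃ i, Occurs i t := by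
  induction h with
  | var i => exact ⟨i, rfl⟩
  | app u _ ih => exact ih.imp fun _ => Or.inl

/-- A closed normal term is an abstraction, so applying a closed term always leaves a redex. -/
theorem not_normal_app_of_closed {t : Term} (h : Closed t) (u : Term) : ¬ Normal (app t u) := by
  intro hn
  cases hn.appL.headNormal with
  | head ht =>
    obtain ⟨i, hi⟩ := ht.not_closed
    exact closed_iff.1 h i hi
  | lam _ => exact hn _ (Beta.beta _ _)

theorem OmegaStep.not_normal {t t' : Term} (h : OmegaStep t t') : ¬ Normal t := by
  induction h with
  | omega h => exact fun hn => h ⟨_, .refl, hn.headNormal⟩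
  | appL _ ih => exact fun hn => ih hn.appL
  | appR _ ih => exact fun hn => ih hn.appR
  | lam _ ih => exact fun hn => ih hn.lam

theorem normal_delta : Normal delta := by
  intro s h
  rcases h with _ | _ | _ | ⟨_ | h | h⟩ <;> cases h

theorem Reduces.appL {t t' : Term} (h : Reduces t t') (u : Term) :
    Reduces (app t u) (app t' u) := by
  induction h with
  | refl => exact .refl
  | tail _ h ih => exact ih.tail (h.imp .appL .appL)

theorem Reduces.appR {u u' : Term} (h : Reduces u u') (t : Term) :
    Reduces (app t u) (app t u') := by
  induction h with
  | refl => exact .refl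
  | tail _ h ih => exact ih.tail (h.imp .appR .appR)

theorem Reduces.lam {t t' : Term} (h : Reduces t t') : Reduces (lam t) (lam t') := by
  induction h with
  | refl => exact .refl
  | tail _ h ih => exact ih.tail (h.imp .lam .lam)

theorem reduces_of_beta {t t' : Term} (h : Relation.ReflTransGen Beta t t') : Reduces t t' := by
  induction h with
  | refl => exact .refl
  | tail _ h ih => exact ih.tail (Or.inl h)

/-! ### Lifting reductions through the substitution of a variable that is never applied -/

/-- The substitution `s` sends every variable to a variable, or to the term `r`; the latter only
happens for variables that are applied in no reduct of `t`. -/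
def Inert (r : Term) (s : ℕ → Term) (t : Term) : Prop :=
  ∀ i, (∃ j, s i = var j) ∨ (s i = r ∧ ∀ t', Reduces t t' → ¬ Applied i t')

theorem Inert.of_reduces {r : Term} {s : ℕ → Term} {t t' : Term} (h : Inert r s t)
    (ht : Reduces t t') : Inert r s t' :=
  fun i => (h i).imp_right fun ⟨e, hi⟩ => ⟨e, fun _ h' => hi _ (ht.trans h')⟩

theorem Inert.appL {r : Term} {s : ℕ → Term} {t u : Term} (h : Inert r s (app t u)) :
    Inert r s t :=
  fun i => (h i).imp_right fun ⟨e, hi⟩ =>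
    ⟨e, fun _ h' ha => hi _ (h'.appL u) (Or.inr (Or.inl ha))⟩

theorem Inert.appR {r : Term} {s : ℕ → Term} {t u : Term} (h : Inert r s (app t u)) :
    Inert r s u :=
  fun i => (h i).imp_right fun ⟨e, hi⟩ =>
    ⟨e, fun _ h' ha => hi _ (h'.appR t) (Or.inr (Or.inr ha))⟩

theorem Inert.lam {r : Term} (hr : Closed r) {s : ℕ → Term} {t : Term}
    (h : Inert r s (lam t)) : Inert r (up s) t := by
  intro i
  cases i with
  | zero => exact Or.inl ⟨0, rfl⟩
  | succ i =>
    rcases h i with ⟨j, e⟩ | ⟨e, hi⟩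
    · exact Or.inl ⟨j + 1, by simp only [up, e, rename]⟩
    · exact Or.inr ⟨by simp only [up, e, hr.rename_eq], fun _ h' ha => hi _ h'.lam ha⟩

/-- In head position, followed by an argument, there can only be a variable that the substitution
sends to a variable. -/
theorem Inert.varHeaded {r : Term} {s : ℕ → Term} {t : Term} (ht : VarHeaded t) :
    ∀ {u}, Inert r s (app t u) → VarHeaded (subst s t) := by
  induction ht with
  | var i =>
    intro u h
    rcases h i with ⟨j, e⟩ | ⟨_, hi⟩
    · simp only [subst, e]
      exact .var j
    · exact absurd (Or.inl rfl) (hi _ .refl)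
  | app _ _ ih => exact fun h => .app _ (ih h.appL)

theorem Inert.headNormal {r : Term} (hr : Closed r) (hn : Normal r) {t : Term}
    (ht : HeadNormal t) : ∀ {s : ℕ → Term}, Inert r s t → HeadNormal (subst s t) := by
  induction ht with
  | head ht =>
    intro s h
    cases ht with
    | var i =>
      rcases h i with ⟨j, e⟩ | ⟨e, _⟩
      · simp only [subst, e]
        exact .head (.var j)
      · simp only [subst, e]
        exact hn.headNormal
    | app u ht => exact .head (.app _ (h.varHeaded ht))
  | lam _ ih => exact fun h => .lam (ih (h.lam hr))

theorem Inert.solvable {r : Term} (hr : Closed r) (hn : Normal r) {s : ℕ → Term} {t : Term}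
    (h : Inert r s t) (ht : Solvable t) : Solvable (subst s t) := by
  obtain ⟨v, hv, hh⟩ := ht
  refine ⟨subst s v, ?_, (h.of_reduces (reduces_of_beta hv)).headNormal hr hn hh⟩
  clear hh
  induction hv with
  | refl => exact .refl
  | tail _ h' ih => exact ih.tail (h'.subst s)

theorem Inert.lift_beta {r : Term} (hr : Closed r) (hn : Normal r) {t : Term} :
    ∀ {s : ℕ → Term} {w : Term}, Inert r s t → Beta (subst s t) w →
      ∃ t', Beta t t' ∧ w = subst s t' := by
  induction t with
  | var i =>
    intro s w h hb
    simp only [subst] at hb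
    rcases h i with ⟨j, e⟩ | ⟨e, _⟩
    · rw [e] at hb
      cases hb
    · rw [e] at hb
      exact absurd hb (hn w)
  | app t u iht ihu =>
    intro s w h hb
    simp only [subst] at hb
    generalize ht : subst s t = t₁ at hb
    cases hb with
    | beta q =>
      cases t with
      | var i =>
        rcases h i with ⟨j, e⟩ | ⟨_, hi⟩
        · simp only [subst, e] at ht
          cases ht
        · exact absurd (Or.inl rfl) (hi _ .refl)
      | app _ _ => cases ht
      | lam t =>
        cases ht
        exact ⟨_, .beta t u, (subst_inst s t u).symm⟩
    | appL hb =>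
      obtain ⟨t', ht', rfl⟩ := iht h.appL (ht ▸ hb)
      exact ⟨_, .appL ht', rfl⟩
    | appR hb =>
      obtain ⟨u', hu', rfl⟩ := ihu h.appR hb
      exact ⟨_, .appR hu', by rw [← ht]; rfl⟩
  | lam t ih =>
    intro s w h hb
    cases hb with
    | lam hb =>
      obtain ⟨t', ht', rfl⟩ := ih (h.lam hr) hb
      exact ⟨_, .lam ht', rfl⟩

theorem Inert.lift_omegaStep {r : Term} (hr : Closed r) (hn : Normal r) {t : Term} :
    ∀ {s : ℕ → Term} {w : Term}, Inert r s t → OmegaStep (subst s t) w →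
      ∃ t', OmegaStep t t' ∧ w = subst s t' := by
  induction t with
  | var i =>
    intro s w h ho
    refine absurd ?_ ho.not_normal
    simp only [subst]
    rcases h i with ⟨j, e⟩ | ⟨e, _⟩
    · rw [e]
      exact fun _ hb => nomatch hb
    · rwa [e]
  | app t u iht ihu =>
    intro s w h ho
    cases ho with
    | omega ho => exact ⟨_, .omega fun ht => ho (h.solvable hr hn ht), rfl⟩
    | appL ho =>
      obtain ⟨t', ht', rfl⟩ := iht h.appL ho
      exact ⟨_, .appL ht', rfl⟩
    | appR ho =>
      obtain ⟨u', hu', rfl⟩ := ihu h.appR ho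
      exact ⟨_, .appR hu', rfl⟩
  | lam t ih =>
    intro s w h ho
    cases ho with
    | omega ho => exact ⟨_, .omega fun ht => ho (h.solvable hr hn ht), rfl⟩
    | lam ho =>
      obtain ⟨t', ht', rfl⟩ := ih (h.lam hr) ho
      exact ⟨_, .lam ht', rfl⟩

/-- Substituting a closed normal term for variables that are never applied creates neither
beta-redexes nor unsolvable sub-terms: every reduction of the instance comes from the original. -/
theorem Inert.lift_reduces {r : Term} (hr : Closed r) (hn : Normal r) {s : ℕ → Term} {t w : Term}
    (h : Inert r s t) (hw : Reduces (subst s t) w) : ∃ t', Reduces t t' ∧ w = subst s t' := by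
  induction hw with
  | refl => exact ⟨t, .refl, rfl⟩
  | tail _ hs ih =>
    obtain ⟨t', ht', rfl⟩ := ih
    rcases hs with hs | hs
    · obtain ⟨v, hv, rfl⟩ := (h.of_reduces ht').lift_beta hr hn hs
      exact ⟨v, ht'.tail (Or.inl hv), rfl⟩
    · obtain ⟨v, hv, rfl⟩ := (h.of_reduces ht').lift_omegaStep hr hn hs
      exact ⟨v, ht'.tail (Or.inr hv), rfl⟩

/-! ### A type system that confines the variable `ν` -/

/-- Types. `top` is the type of an arbitrary term, seen as a function from arbitrary terms to
arbitrary terms; `name` is the type of `ν`; `data` is the type of the terms built from parameters of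
that type only (such as numerals); `self a` is a type that satisfies `self a = (self a → a)`, needed
for the self-application in Turing's fixed point operator. -/
inductive Ty : Type
  | top : Ty
  | name : Ty
  | data : Ty
  | arr : Ty → Ty → Ty
  | self : Ty → Ty

/-- A term of type `a` may only have free variables of types of rank at least `rank a`. So terms of
function type contain neither `ν` nor a variable for an arbitrary term. -/
def Ty.rank : Ty → ℕ
  | .top => 0
  | .name => 0
  | .data => 2
  | .arr _ _ => 1
  | .self _ => 1

/-- `Unfold c a b`: a term of type `c` can be applied to terms of type `a`, with a result of
type `b`. -/
inductive Unfold : Ty → Ty → Ty → Prop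
  | top : Unfold .top .top .top
  | arr (a b : Ty) : Unfold (.arr a b) a b
  | self (a : Ty) : Unfold (.self a) (.self a) a

theorem Unfold.unique {c a b a' b' : Ty} (h : Unfold c a b) (h' : Unfold c a' b') :
    a = a' ∧ b = b' := by
  cases h <;> cases h' <;> exact ⟨rfl, rfl⟩

/-- Extension of a context by the type of the variable `0`. -/
def cons (a : Ty) (Γ : ℕ → Ty) : ℕ → Ty
  | 0 => a
  | i + 1 => Γ i

/-- All free variables of `t` have types of rank at least `n` in the context `Γ`. -/
def RankGE (n : ℕ) (Γ : ℕ → Ty) (t : Term) : Prop :=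
  ∀ i, Occurs i t → n ≤ (Γ i).rank

/-- The typing relation. The term `Ω` has every type, so that typing survives Omega-reduction. -/
inductive HasTy : (ℕ → Ty) → Term → Ty → Prop
  | var (Γ : ℕ → Ty) (i : ℕ) : HasTy Γ (var i) (Γ i)
  | varTop {Γ : ℕ → Ty} {i : ℕ} : Γ i = .data → HasTy Γ (var i) .top
  | data {Γ : ℕ → Ty} {t : Term} : RankGE 2 Γ t → HasTy Γ t .data
  | app {Γ : ℕ → Ty} {t u : Term} {c a b : Ty} : Unfold c a b → HasTy Γ t c → HasTy Γ u a →
      RankGE b.rank Γ (app t u) → HasTy Γ (app t u) b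
  | lam {Γ : ℕ → Ty} {t : Term} {c a b : Ty} : Unfold c a b → HasTy (cons a Γ) t b →
      RankGE c.rank Γ (lam t) → HasTy Γ (lam t) c
  | omega {Γ : ℕ → Ty} {t : Term} (a : Ty) : t = Omega → HasTy Γ t a

theorem rankGE_zero (Γ : ℕ → Ty) (t : Term) : RankGE 0 Γ t := fun _ _ => Nat.zero_le _

theorem eq_data_of_rank {a : Ty} (h : 2 ≤ a.rank) : a = .data := by
  cases a <;> simp_all [Ty.rank]

theorem HasTy.rankGE {Γ : ℕ → Ty} {t : Term} {a : Ty} (h : HasTy Γ t a) : RankGE a.rank Γ t := by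
  cases h with
  | var i => intro j hj; cases hj; exact le_rfl
  | varTop _ => exact rankGE_zero _ _
  | data h => exact h
  | app _ _ _ h => exact h
  | lam _ _ h => exact h
  | omega _ h => subst h; exact fun i hi => absurd hi (not_occurs_omega i)

theorem hasTy_top {t : Term} : ∀ {Γ : ℕ → Ty}, (∀ i, Occurs i t → Γ i = .top ∨ Γ i = .data) →
    HasTy Γ t .top := by
  induction t with
  | var i =>
    intro Γ h
    rcases h i rfl with h | h
    · have := HasTy.var Γ i
      rwa [h] at this
    · exact .varTop h
  | app t u iht ihu =>
    intro Γ h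
    exact .app .top (iht fun i hi => h i (Or.inl hi)) (ihu fun i hi => h i (Or.inr hi))
      (rankGE_zero _ _)
  | lam t ih =>
    intro Γ h
    refine .lam .top (ih fun i hi => ?_) (rankGE_zero _ _)
    cases i with
    | zero => exact Or.inl rfl
    | succ i => exact h i hi

theorem Closed.hasTy_top {t : Term} (h : Closed t) (Γ : ℕ → Ty) : HasTy Γ t .top :=
  Term.hasTy_top fun i hi => absurd hi (closed_iff.1 h i)

theorem HasTy.top_of_data {Γ : ℕ → Ty} {t : Term} (h : HasTy Γ t .data) : HasTy Γ t .top :=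
  Term.hasTy_top fun i hi => Or.inr (eq_data_of_rank (h.rankGE i hi))

theorem HasTy.rename {Γ : ℕ → Ty} {t : Term} {a : Ty} (h : HasTy Γ t a) :
    ∀ {Δ : ℕ → Ty} {r : ℕ → ℕ}, (∀ i, Δ (r i) = Γ i) → HasTy Δ (rename r t) a := by
  have ge : ∀ {Γ Δ : ℕ → Ty} {r : ℕ → ℕ} {n : ℕ} {t : Term}, (∀ i, Δ (r i) = Γ i) →
      RankGE n Γ t → RankGE n Δ (Term.rename r t) := by
    intro Γ Δ r n t hr h j hj
    obtain ⟨i, hi, rfl⟩ := occurs_rename.1 hj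
    rw [hr]
    exact h i hi
  induction h with
  | var Γ i => intro Δ r hr; rw [← hr i]; exact .var Δ (r i)
  | varTop h => intro Δ r hr; exact .varTop ((hr _).trans h)
  | data h => intro Δ r hr; exact .data (ge hr h)
  | app hu _ _ h iht ihu => intro Δ r hr; exact .app hu (iht hr) (ihu hr) (ge hr h)
  | lam hu _ h ih =>
    intro Δ r hr
    have h' := ge hr h
    rw [rename_lam] at h' ⊢
    refine .lam hu (ih fun i => ?_) h'
    cases i with
    | zero => rfl
    | succ i => exact hr i
  | omega a h => intro Δ r _; subst h; exact .omega a rfl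

theorem HasTy.subst {Γ : ℕ → Ty} {t : Term} {a : Ty} (h : HasTy Γ t a) :
    ∀ {Δ : ℕ → Ty} {s : ℕ → Term}, (∀ i, HasTy Δ (s i) (Γ i)) → HasTy Δ (subst s t) a := by
  have ge : ∀ {Γ Δ : ℕ → Ty} {s : ℕ → Term} {n : ℕ} {t : Term}, (∀ i, HasTy Δ (s i) (Γ i)) →
      RankGE n Γ t → RankGE n Δ (Term.subst s t) := by
    intro Γ Δ s n t hs h j hj
    obtain ⟨i, hi, hj⟩ := occurs_subst.1 hj
    exact (h i hi).trans ((hs i).rankGE j hj)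
  induction h with
  | var Γ i => intro Δ s hs; exact hs i
  | varTop h => intro Δ s hs; exact (h ▸ hs _).top_of_data
  | data h => intro Δ s hs; exact .data (ge hs h)
  | app hu _ _ h iht ihu => intro Δ s hs; exact .app hu (iht hs) (ihu hs) (ge hs h)
  | lam hu _ h ih =>
    intro Δ s hs
    refine .lam hu (ih fun i => ?_) (ge hs h)
    cases i with
    | zero => exact .var _ 0
    | succ i => exact (hs i).rename fun _ => rfl
  | omega a h => intro Δ s _; subst h; exact .omega a rfl

theorem HasTy.inst {Γ : ℕ → Ty} {t u : Term} {a b : Ty} (ht : HasTy (cons a Γ) t b)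
    (hu : HasTy Γ u a) : HasTy Γ (inst t u) b := by
  rw [inst_eq]
  refine ht.subst fun i => ?_
  cases i with
  | zero => exact hu
  | succ i => exact .var Γ i

theorem HasTy.beta {t t' : Term} (hb : Beta t t') :
    ∀ {Γ : ℕ → Ty} {a : Ty}, HasTy Γ t a → HasTy Γ t' a := by
  have ge : ∀ {Γ : ℕ → Ty} {n : ℕ} {t t' : Term}, Beta t t' → RankGE n Γ t → RankGE n Γ t' :=
    fun hb h i hi => h i (hb.occurs hi)
  induction hb with
  | beta t u =>
    intro Γ a h
    cases h with
    | data h => exact .data (ge (.beta t u) h)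
    | app hu ht h' _ =>
      cases ht with
      | data _ => cases hu
      | lam hu' ht _ =>
        obtain ⟨rfl, rfl⟩ := hu.unique hu'
        exact ht.inst h'
      | omega _ e => cases e
    | omega a e => cases e; exact .omega a rfl
  | appL hb ih =>
    intro Γ a h
    cases h with
    | data h => exact .data (ge (.appL hb) h)
    | app hu ht h' hr => exact .app hu (ih ht) h' (ge (.appL hb) hr)
    | omega a e => cases e; exact absurd hb (normal_delta _)
  | appR hb ih =>
    intro Γ a h
    cases h with
    | data h => exact .data (ge (.appR hb) h)
    | app hu ht h' hr => exact .app hu ht (ih h') (ge (.appR hb) hr)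
    | omega a e => cases e; exact absurd hb (normal_delta _)
  | lam hb ih =>
    intro Γ a h
    cases h with
    | data h => exact .data (ge (.lam hb) h)
    | lam hu ht hr => exact .lam hu (ih ht) (ge (.lam hb) hr)
    | omega a e => cases e

theorem HasTy.omegaStep {t t' : Term} (ho : OmegaStep t t') :
    ∀ {Γ : ℕ → Ty} {a : Ty}, HasTy Γ t a → HasTy Γ t' a := by
  have ge : ∀ {Γ : ℕ → Ty} {n : ℕ} {t t' : Term}, OmegaStep t t' → RankGE n Γ t → RankGE n Γ t' :=
    fun ho h i hi => h i (ho.occurs hi)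
  induction ho with
  | omega _ => exact fun _ => .omega _ rfl
  | appL ho ih =>
    intro Γ a h
    cases h with
    | data h => exact .data (ge (.appL ho) h)
    | app hu ht h' hr => exact .app hu (ih ht) h' (ge (.appL ho) hr)
    | omega a e => cases e; exact absurd normal_delta ho.not_normal
  | appR ho ih =>
    intro Γ a h
    cases h with
    | data h => exact .data (ge (.appR ho) h)
    | app hu ht h' hr => exact .app hu ht (ih h') (ge (.appR ho) hr)
    | omega a e => cases e; exact absurd normal_delta ho.not_normal
  | lam ho ih =>
    intro Γ a h
    cases h with
    | data h => exact .data (ge (.lam ho) h)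
    | lam hu ht hr => exact .lam hu (ih ht) (ge (.lam ho) hr)
    | omega a e => cases e

theorem HasTy.reduces {Γ : ℕ → Ty} {t t' : Term} {a : Ty} (h : HasTy Γ t a)
    (ht : Reduces t t') : HasTy Γ t' a := by
  induction ht with
  | refl => exact h
  | tail _ hs ih => exact hs.elim (fun hb => ih.beta hb) fun ho => ih.omegaStep ho

/-! ### Occurrences of `ν` in typed terms -/

/-- A typed term in which `ν` occurs, all free variables having types of rank `0`, is `ν` itself or
contains a redex: the occurrence of `ν` lies in the argument of some `(P u)` where `P` has a function
type, hence is closed. -/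
theorem HasTy.not_normal {Γ : ℕ → Ty} {t : Term} {a : Ty} (h : HasTy Γ t a) {k : ℕ}
    (hk : Occurs k t) (hΓ : ∀ i, Occurs i t → (Γ i).rank = 0) (hn : Γ k = .name) :
    (a = .name ∧ ∃ i, t = Term.var i) ∨ ¬ Normal t := by
  induction h generalizing k with
  | var Γ i => cases hk; exact Or.inl ⟨hn, i, rfl⟩
  | varTop h => cases hk; rw [h] at hn; cases hn
  | data h =>
    have := h k hk
    rw [hn] at this
    cases this
  | @app Γ t u c a b hu ht _ _ iht ihu =>
    have closed : 1 ≤ c.rank → ¬ Normal (Term.app t u) := fun hc =>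
      not_normal_app_of_closed (closed_iff.2 fun i hi => by
        have h₁ := ht.rankGE i hi
        have h₂ := hΓ i (Or.inl hi)
        omega) u
    cases hu with
    | top =>
      right
      intro hnt
      rcases hk with hk | hk
      · exact (iht hk (fun i hi => hΓ i (Or.inl hi)) hn).elim nofun fun h => h hnt.appL
      · exact (ihu hk (fun i hi => hΓ i (Or.inr hi)) hn).elim nofun fun h => h hnt.appR
    | arr => exact Or.inr (closed le_rfl)
    | self => exact Or.inr (closed le_rfl)
  | @lam Γ t c a b hu _ hr ih =>
    have hc := hr k hk
    rw [hn] at hc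
    cases hu with
    | top =>
      right
      intro hnt
      refine (ih (k := k + 1) hk (fun i hi => ?_) hn).elim nofun fun h => h hnt.lam
      cases i with
      | zero => rfl
      | succ i => exact hΓ i hi
    | arr => cases hc
    | self => cases hc
  | omega _ h => subst h; exact absurd hk (not_occurs_omega k)

theorem HasTy.of_app {Γ : ℕ → Ty} {t u : Term} {a : Ty} (h : HasTy Γ (Term.app t u) a) :
    Term.app t u = Omega ∨ (∃ b, HasTy Γ t b) ∧ ∃ b, HasTy Γ u b := by
  cases h with
  | data h =>
    exact Or.inr ⟨⟨_, .data fun i hi => h i (Or.inl hi)⟩, ⟨_, .data fun i hi => h i (Or.inr hi)⟩⟩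
  | app _ ht hu _ => exact Or.inr ⟨⟨_, ht⟩, ⟨_, hu⟩⟩
  | omega _ e => exact Or.inl e

theorem HasTy.of_lam {Γ : ℕ → Ty} {t : Term} {a : Ty} (h : HasTy Γ (Term.lam t) a) :
    ∃ c b, HasTy (cons c Γ) t b := by
  cases h with
  | data h =>
    refine ⟨.data, .data, .data fun i hi => ?_⟩
    cases i with
    | zero => exact le_rfl
    | succ i => exact h i hi
  | lam _ ht _ => exact ⟨_, _, ht⟩
  | omega _ e => cases e

/-- If an instance of a typed term that is not a variable is closed and normal, only `ν` being
instantiated, then `ν` does not occur in that term. -/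
theorem HasTy.closed_instance {r : Term} {Γ : ℕ → Ty} {t : Term} {a : Ty} {s : ℕ → Term}
    (h : HasTy Γ t a) (hs : ∀ i, (∃ j, s i = Term.var j) ∨ (s i = r ∧ Γ i = .name))
    (hc : Closed (Term.subst s t)) (hn : Normal (Term.subst s t)) (hv : ∀ i, t ≠ Term.var i) :
    Term.subst s t = t := by
  refine Closed.subst_eq (closed_iff.2 fun k hk => ?_) s
  have hname : ∀ i, Occurs i t → Γ i = .name := by
    intro i hi
    refine (hs i).elim (fun ⟨j, e⟩ => ?_) And.right
    exact absurd (occurs_subst.2 ⟨i, hi, by rw [e]; rfl⟩) (closed_iff.1 hc j)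
  rcases h.not_normal hk (fun i hi => by rw [hname i hi]; rfl) (hname k hk) with ⟨_, i, e⟩ | h
  · exact hv i e
  · exact h fun _ hb => hn _ (hb.subst s)

/-- If the closed normal term `q` is a sub-term of an instance of a typed term `t`, where only `ν`
is instantiated by a closed term `r`, then `q` is a sub-term of `r` or of `t`: it cannot
overlap both. -/
theorem HasTy.subterm_subst {q r : Term} (hq : Closed q) (hqn : Normal q) (hr : Closed r)
    {t : Term} : ∀ {Γ : ℕ → Ty} {a : Ty} {s : ℕ → Term}, HasTy Γ t a →
      (∀ i, (∃ j, s i = Term.var j) ∨ (s i = r ∧ Γ i = .name)) →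
      Subterm q (Term.subst s t) → Subterm q r ∨ Subterm q t := by
  induction t with
  | var i =>
    intro Γ a s _ hs hsub
    simp only [Term.subst] at hsub
    rcases hs i with ⟨j, e⟩ | ⟨e, _⟩
    · rw [e] at hsub
      cases hsub
      exact absurd hq (Nat.not_lt_zero j)
    · rw [e] at hsub
      exact Or.inl hsub
  | app t u iht ihu =>
    intro Γ a s h hs hsub
    by_cases hroot : q = Term.subst s (Term.app t u)
    · right
      have e := h.closed_instance hs (hroot ▸ hq) (hroot ▸ hqn) nofun
      rw [hroot, e]
      exact .refl _
    rcases h.of_app with e | ⟨⟨b, ht⟩, ⟨c, hu⟩⟩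
    · rw [e] at hsub ⊢
      exact Or.inr hsub
    · cases hsub with
      | refl => exact absurd rfl hroot
      | appL hsub => exact (iht ht hs hsub).imp_right .appL
      | appR hsub => exact (ihu hu hs hsub).imp_right .appR
  | lam t ih =>
    intro Γ a s h hs hsub
    by_cases hroot : q = Term.subst s (Term.lam t)
    · right
      have e := h.closed_instance hs (hroot ▸ hq) (hroot ▸ hqn) nofun
      rw [hroot, e]
      exact .refl _
    obtain ⟨c, b, ht⟩ := h.of_lam
    cases hsub with
    | refl => exact absurd rfl hroot
    | lam hsub =>
      refine (ih ht (fun i => ?_) hsub).imp_right .lam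
      cases i with
      | zero => exact Or.inl ⟨0, rfl⟩
      | succ i =>
        rcases hs i with ⟨j, e⟩ | ⟨e, hi⟩
        · exact Or.inl ⟨j + 1, by simp only [up, e, Term.rename]⟩
        · exact Or.inr ⟨by simp only [up, e, hr.rename_eq], hi⟩

theorem subterm_subst_of_occurs {r : Term} (hr : Closed r) {t : Term} :
    ∀ {i : ℕ} {s : ℕ → Term}, Occurs i t → s i = r → Subterm r (subst s t) := by
  induction t with
  | var j => intro i s hi e; cases hi; rw [subst, e]; exact .refl r
  | app t u iht ihu =>
    exact fun hi e => hi.elim (fun hi => .appL (iht hi e)) fun hi => .appR (ihu hi e)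
  | lam t ih =>
    intro i s hi e
    exact .lam (ih hi (by simp only [up, e, hr.rename_eq]))

theorem Subterm.sizeOf_le {t u : Term} (h : Subterm t u) : t = u ∨ sizeOf t < sizeOf u := by
  induction h with
  | refl => exact Or.inl rfl
  | appL _ ih => right; rcases ih with rfl | ih <;> simp only [app.sizeOf_spec] <;> omega
  | appR _ ih => right; rcases ih with rfl | ih <;> simp only [app.sizeOf_spec] <;> omega
  | lam _ ih => right; rcases ih with rfl | ih <;> simp only [lam.sizeOf_spec] <;> omega

theorem Subterm.antisymm {t u : Term} (h : Subterm t u) (h' : Subterm u t) : t = u := by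
  rcases h.sizeOf_le with e | h
  · exact e
  · rcases h'.sizeOf_le with e | h'
    · exact e.symm
    · omega

/-! ### Typing the infinite eta-expansions -/

theorem Closed.rankGE {t : Term} (h : Closed t) (n : ℕ) (Γ : ℕ → Ty) : RankGE n Γ t :=
  fun i hi => absurd hi (closed_iff.1 h i)

theorem closed_turing : Closed turing := by
  simp [turing, turingHalf, Closed, ClosedBelow]

/-- Turing's fixed point operator takes a function on a function type `a → b` to an element of that
type. -/
theorem hasTy_turing (Γ : ℕ → Ty) (a b : Ty) :
    HasTy Γ turing (.arr (.arr (.arr a b) (.arr a b)) (.arr a b)) := by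
  have half : HasTy Γ turingHalf (.self (.arr (.arr (.arr a b) (.arr a b)) (.arr a b))) := by
    refine .lam (.self _) (.lam (.arr _ _) (.app (.arr _ _) (.var _ 0)
      (.app (.arr _ _) (.app (.self _) (.var _ 1) (.var _ 1) ?_) (.var _ 0) ?_) ?_) ?_) ?_ <;>
    · intro i hi
      rcases i with _ | _ | i <;> simp_all [Occurs, cons, Ty.rank]
  exact .app (.self _) half half (closed_turing.rankGE _ _)

theorem closedBelow_lams {t : Term} : ∀ {p k : ℕ}, ClosedBelow (k + p) t →
    ClosedBelow k (lams p t)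
  | 0, _, h => h
  | p + 1, k, h => by
    refine closedBelow_lams (p := p) (k := k + 1) ?_
    rwa [Nat.add_right_comm]

theorem closedBelow_apps {k : ℕ} {l : List Term} : ∀ {t : Term}, ClosedBelow k t →
    (∀ u ∈ l, ClosedBelow k u) → ClosedBelow k (apps t l) := by
  induction l with
  | nil => exact fun h _ => h
  | cons u l ih =>
    intro t ht hl
    exact ih (t := app t u) ⟨ht, hl u (by simp)⟩ fun v hv => hl v (by simp [hv])

theorem hasTy_apps {Γ : ℕ → Ty} {l : List Term} : ∀ {t : Term}, HasTy Γ t .top →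
    (∀ u ∈ l, HasTy Γ u .top) → HasTy Γ (apps t l) .top := by
  induction l with
  | nil => exact fun h _ => h
  | cons u l ih =>
    intro t ht hl
    exact ih (t := app t u) (.app .top ht (hl u (by simp)) (rankGE_zero _ _))
      fun v hv => hl v (by simp [hv])

theorem hasTy_lams {t : Term} : ∀ {p : ℕ} {Γ : ℕ → Ty}, HasTy ((cons .top)^[p] Γ) t .top →
    HasTy Γ (lams p t) .top
  | 0, _, h => h
  | _ + 1, _, h => .lam .top (hasTy_lams h) (rankGE_zero _ _)

theorem iterate_cons_of_lt (a : Ty) (Γ : ℕ → Ty) : ∀ {p i : ℕ}, i < p →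
    (cons a)^[p] Γ i = a
  | p + 1, 0, _ => by rw [Function.iterate_succ_apply']; rfl
  | p + 1, i + 1, h => by
    rw [Function.iterate_succ_apply']
    exact iterate_cons_of_lt a Γ (Nat.lt_of_succ_lt_succ h)

theorem iterate_cons_add (a : Ty) (Γ : ℕ → Ty) : ∀ p i : ℕ, (cons a)^[p] Γ (p + i) = Γ i
  | 0, i => by simp
  | p + 1, i => by
    rw [Function.iterate_succ_apply', Nat.add_right_comm]
    exact iterate_cons_add a Γ p i

theorem hasTy_J (Γ : ℕ → Ty) (p : ℕ) : HasTy Γ (J p) (.arr .name .top) := by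
  have hbody : ClosedBelow (3 + p) (apps (var p)
      ((List.range p).reverse.map (fun i => app (app (var (p + 2)) (var (p + 1))) (var i)))) := by
    refine closedBelow_apps (by simp [ClosedBelow]) ?_
    simp only [List.mem_map, List.mem_reverse, List.mem_range]
    rintro _ ⟨i, hi, rfl⟩
    simp only [ClosedBelow]
    omega
  have h₃ := closedBelow_lams (p := p) hbody
  have h₀ : Closed (J p) := ⟨closed_turing, h₃⟩
  refine .app (.arr _ _) (hasTy_turing Γ _ _) ?_ (h₀.rankGE _ _)
  refine .lam (.arr _ _) (.lam (.arr _ _) (.lam .top (hasTy_lams (hasTy_apps ?_ ?_))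
    (rankGE_zero _ _)) ?_) (Closed.rankGE h₀.2 _ _)
  · have := HasTy.var ((cons .top)^[p] (cons .top (cons .name (cons (.arr .name .top) Γ)))) p
    rwa [show (cons .top)^[p] (cons .top (cons .name (cons (.arr .name .top) Γ))) p = .top from
      iterate_cons_add .top _ p 0] at this
  · simp only [List.mem_map, List.mem_reverse, List.mem_range]
    rintro _ ⟨i, hi, rfl⟩
    generalize hΔ : (cons .top)^[p] (cons .top (cons .name (cons (.arr .name .top) Γ))) = Δ
    have h₂ : Δ (p + 2) = .arr .name .top := by rw [← hΔ]; exact iterate_cons_add .top _ p 2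
    have h₁ : Δ (p + 1) = .name := by rw [← hΔ]; exact iterate_cons_add .top _ p 1
    have h₀ : Δ i = .top := by rw [← hΔ]; exact iterate_cons_of_lt .top _ hi
    have v₂ := HasTy.var Δ (p + 2)
    have v₁ := HasTy.var Δ (p + 1)
    have v₀ := HasTy.var Δ i
    rw [h₂] at v₂
    rw [h₁] at v₁
    rw [h₀] at v₀
    exact .app .top (.app (.arr _ _) v₂ v₁ (rankGE_zero _ _)) v₀ (rankGE_zero _ _)
  · intro i hi
    have := closedBelow_iff.1 (show ClosedBelow 1 (lam (lam (lams p _))) from h₃) i hi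
    obtain rfl : i = 0 := by omega
    exact le_rfl

theorem Closed.closedBelow {t : Term} (h : Closed t) (k : ℕ) : ClosedBelow k t :=
  closedBelow_iff.2 fun i hi => absurd hi (closed_iff.1 h i)

theorem hasTy_Jhat (Γ : ℕ → Ty) {H S : Term} (hH : Closed H) (hS : Closed S) :
    HasTy Γ (Jhat H S) (.arr .data (.arr .name .top)) := by
  have occH : ∀ i, ¬ Occurs i H := closed_iff.1 hH
  have occS : ∀ i, ¬ Occurs i S := closed_iff.1 hS
  have h₀ : Closed (Jhat H S) := by
    simp [Jhat, Closed, ClosedBelow, apps, I, hH.closedBelow, hS.closedBelow, turing, turingHalf]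
  refine .app (.arr _ _) (hasTy_turing Γ _ _) ?_ (h₀.rankGE _ _)
  refine .lam (.arr _ _) (.lam (.arr _ _) (.lam (.arr _ _) (.lam .top (hasTy_apps
    (hH.hasTy_top _) ?_) (rankGE_zero _ _)) ?_) ?_) ?_
  · simp only [List.forall_mem_cons]
    refine ⟨.varTop rfl, ?_, Closed.hasTy_top (by simp [I, Closed, ClosedBelow]) _, .var _ 0,
      by simp⟩
    refine .lam .top (.lam .top (.lam .top (.app .top (.var _ 2) (.app .top (.var _ 1)
      (.app .top (.app (.arr _ _) (.app (.arr _ _) (.var _ 6) (.data ?_) ?_) (.var _ 4)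
      (rankGE_zero _ _)) (.var _ 0) (rankGE_zero _ _)) (rankGE_zero _ _)) (rankGE_zero _ _))
      (rankGE_zero _ _)) (rankGE_zero _ _)) (rankGE_zero _ _)
    · intro i hi
      obtain rfl : 5 = i := hi.resolve_left (occS i)
      exact le_rfl
    · intro i hi
      rcases hi with hi | hi | hi
      · obtain rfl : 6 = i := hi
        exact le_rfl
      · exact absurd hi (occS i)
      · obtain rfl : 5 = i := hi
        exact Nat.le_succ 1
  all_goals
    intro i hi
    rcases i with _ | _ | i <;> simp_all [Occurs, cons, Ty.rank, apps, I]

theorem closed_church (k : ℕ) : Closed (church k) := by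
  have : ClosedBelow 2 ((app (var 1))^[k] (var 0)) := by
    induction k with
    | zero => simp [ClosedBelow]
    | succ k ih => rw [Function.iterate_succ_apply']; exact ⟨by simp [ClosedBelow], ih⟩
  exact this

/-- The context in which the variable `0` is `ν`, all other variables being arbitrary. -/
def nameCtx : ℕ → Ty := cons .name fun _ => .top

theorem IsExpansion.hasTy {A A' : Term} (hA : Closed A) (h : IsExpansion A A') :
    HasTy nameCtx A' .top := by
  rcases h with ⟨p, rfl⟩ | ⟨h, H, S, hH, hS, rfl⟩
  · exact .app .top (.app (.arr _ _) (hasTy_J _ p) (.var _ 0) (rankGE_zero _ _))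
      (hA.hasTy_top _) (rankGE_zero _ _)
  · have hc : RankGE 1 nameCtx (app (Jhat H S) (church 0)) := by
      refine fun i hi => hi.elim (fun hi => ?_) fun hi => (closed_church 0).rankGE 1 _ i hi
      exact (hasTy_Jhat nameCtx hH.1 hS.1).rankGE i hi
    exact .app .top (.app (.arr _ _) (.app (.arr _ _) (hasTy_Jhat _ hH.1 hS.1)
      (.data ((closed_church 0).rankGE _ _)) hc) (.var _ 0) (rankGE_zero _ _))
      (hA.hasTy_top _) (rankGE_zero _ _)

theorem IsExpansion.closedBelow {A A' : Term} (hA : Closed A) (h : IsExpansion A A') :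
    ClosedBelow 1 A' := by
  have occ : ∀ {Γ : ℕ → Ty}, (∀ i, (Γ i).rank = 0) → ∀ {t a}, 1 ≤ a.rank → HasTy Γ t a →
      Closed t := fun hΓ _ _ ha ht => closed_iff.2 fun i hi => by
    have h₁ := ht.rankGE i hi
    have h₂ := hΓ i
    omega
  rcases h with ⟨p, rfl⟩ | ⟨h, H, S, hH, hS, rfl⟩
  · exact ⟨⟨(occ (fun _ => rfl) le_rfl (hasTy_J (fun _ => .top) p)).closedBelow 1, Nat.one_pos⟩,
      hA.closedBelow 1⟩
  · exact ⟨⟨⟨(occ (fun _ => rfl) le_rfl (hasTy_Jhat (fun _ => .top) hH.1 hS.1)).closedBelow 1,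
      (closed_church 0).closedBelow 1⟩, Nat.one_pos⟩, hA.closedBelow 1⟩

/-! ### Separation of the instances -/

theorem inert_single {r t : Term} (h : ∀ t', Reduces t t' → ¬ Applied 0 t') :
    Inert r (single r) t := by
  intro i
  cases i with
  | zero => exact Or.inr ⟨rfl, h⟩
  | succ i => exact Or.inl ⟨i, rfl⟩

theorem inst_closed {t u : Term} (ht : ClosedBelow 1 t) (hu : Closed u) : Closed (inst t u) := by
  rw [inst_eq, closed_iff]
  intro j hj
  obtain ⟨i, hi, hj⟩ := occurs_subst.1 hj
  obtain rfl : i = 0 := by have := closedBelow_iff.1 ht i hi; omega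
  exact closed_iff.1 hu j hj

theorem inst_inst {F : Term} (hF : ClosedBelow 1 F) (A u : Term) :
    inst F (inst A u) = inst (inst F A) u := by
  simp only [inst_eq]
  rw [subst_subst]
  refine subst_congr fun i hi => ?_
  obtain rfl : i = 0 := by have := closedBelow_iff.1 hF i hi; omega
  rfl

/-- If `ν` is persisting in the typed term `B`, and the instances of `B` at two closed normal
terms `q` and `r` have a common reduct, then `q` is a sub-term of `r` or of a reduct of `B`. -/
theorem subterm_of_hEquiv_inst {B q r : Term} (hB : HasTy nameCtx B .top) (hp : Persisting B)
    (hq : Closed q) (hqn : Normal q) (hr : Closed r) (hrn : Normal r)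
    (h : HEquiv (inst B q) (inst B r)) : Subterm q r ∨ ∃ B', Reduces B B' ∧ Subterm q B' := by
  obtain ⟨w, hw, hw'⟩ := h
  rw [inst_eq] at hw hw'
  obtain ⟨C, hC, rfl⟩ := (inert_single hp.2).lift_reduces hq hqn hw
  obtain ⟨D, hD, e⟩ := (inert_single hp.2).lift_reduces hr hrn hw'
  have hsub : Subterm q (subst (single r) D) :=
    e ▸ subterm_subst_of_occurs hq (hp.1 C hC) rfl
  refine ((hB.reduces hD).subterm_subst hq hqn hr (fun i => ?_) hsub).imp_right
    fun h => ⟨D, hD, h⟩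
  cases i with
  | zero => exact Or.inr ⟨rfl, rfl⟩
  | succ i => exact Or.inl ⟨i, rfl⟩

theorem HEquiv.symm {u v : Term} (h : HEquiv u v) : HEquiv v u :=
  h.imp fun _ => And.symm

theorem hEquiv_of_hClass_eq {u v : Term} (h : hClass u = hClass v) : HEquiv u v := by
  have : v ∈ hClass v := ⟨v, .refl, .refl⟩
  rwa [← h] at this

end Term

end LambdaH

open LambdaH LambdaH.Term in
theorem proposition6p1 (F A A' : Term)
    (hF : Closed (lam F)) (hA : Closed A)
    (hA' : IsExpansion A A')
    (hpers : Persisting (inst F A'))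
    (t : ℕ → Term) (ht : Function.Injective t)
    (htc : ∀ n, Closed (t n)) (htn : ∀ n, Normal (t n))
    (hts : ∀ n t', Reduces (inst F A') t' → ¬ Subterm (t n) t') :
    (hRange F).Infinite ∧
      (∀ n, hClass (inst F (inst A' (t n))) ∈ hRange F) ∧
      (∀ m n, m ≠ n →
        hClass (inst F (inst A' (t m))) ≠ hClass (inst F (inst A' (t n)))) := by
  have hF' : ClosedBelow 1 F := hF
  have hB : HasTy nameCtx (inst F A') .top := by
    refine HasTy.inst (a := .top) (hasTy_top fun i hi => ?_) (hA'.hasTy hA)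
    obtain rfl : i = 0 := by have := closedBelow_iff.1 hF' i hi; omega
    exact Or.inl rfl
  have hmem : ∀ n, hClass (inst F (inst A' (t n))) ∈ hRange F := fun n =>
    ⟨_, inst_closed (hA'.closedBelow hA) (htc n), rfl⟩
  have sub : ∀ m n, HEquiv (inst (inst F A') (t m)) (inst (inst F A') (t n)) →
      Subterm (t m) (t n) := fun m n h =>
    (subterm_of_hEquiv_inst hB hpers (htc m) (htn m) (htc n) (htn n) h).resolve_right
      fun ⟨B', hB', h'⟩ => hts m B' hB' h'
  have hne : ∀ m n, m ≠ n →
      hClass (inst F (inst A' (t m))) ≠ hClass (inst F (inst A' (t n))) := by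
    intro m n hmn e
    rw [inst_inst hF', inst_inst hF'] at e
    have h := hEquiv_of_hClass_eq e
    exact hmn (ht ((sub m n h).antisymm (sub n m h.symm)))
  exact ⟨Set.infinite_of_injective_forall_mem
    (fun m n e => by_contra fun hmn => hne m n hmn e) hmem, hmem, hne⟩
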